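/- A server holds $N$ files $W_1,\dots,W_N$, independent and uniformly distributed over $\{0,1\}^F$, and serves $K\le N$ users over an error-free multicast link. The normalized cache sizes satisfy $0\le m_1\le m_2\le\dots\le m_K$ and $\sum_{j=1}^K m_j\le 1$. *Uncoded placement.* Every bit of every file is stored, uncoded, at some (possibly empty) set of users. The set of allocations is $$\mathfrak A(\bm m)=\Big\{\bm a\in[0,1]^{2^K}:\ \sum_{S\subseteq[K]}a_S=1,\ \sum_{S\ni k}a_S\le m_k\ \text{ for all } k\in[K]\Big\},$$ and a placement has allocation $\bm a\in\mathfrak A(\bm m)$ if, for every $S\subseteq[K]$, exactly $a_SF$ bits of each file are stored exclusively at the users in $S$. *Delivery.* Given a demand vector $\bm d\in[N]^K$, the server sends, for each non-empty $T\subseteq[K]$, a signal $X_{T,\bm d}$ of $\lfloor v_TF\rfloor$ bits ($v_T\ge 0$) that is an arbitrary function of the requested files $W_{d_1},\dots,W_{d_K}$. User $k$ forms an estimate $\hat W_{d_k}$ of $W_{d_k}$ as a function of all the signals and its own cache content. The delivery load is $\sum_{\emptyset\ne T\subseteq[K]}v_T$. A load $R$ is achievable with uncoded placement if for every $\epsilon>0$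 and all sufficiently large $F$ there is such a scheme, with a placement whose allocation is in $\mathfrak A(\bm m)$ and with load $R$, for which $\Pr(\hat W_{d_k}\ne W_{d_k})\le\epsilon$ for all $\bm d\in[N]^K$ and $k\in[K]$. Let $R^*_{\mathfrak A}(\bm m)$ be the infimum of the loads that are achievable with uncoded placement. **Theorem.** The set of loads achievable with uncoded placement is non-empty and bounded below, and $$R^*_{\mathfrak A}(\bm m)=K-\sum_{j=1}^K(K-j+1)\,m_j .$$ Moreover, single-user subfiles and pairwise XORs suffice. Let $F\ge1$ and $n_j=\lfloor m_jF\rfloor$. Then there is a scheme with uncoded placement and allocation $\bm a\in\mathfrak A(\bm m)$ such that: 1. $a_{\{j\}}F=n_j$ for all $j$, and $a_S=0$ whenever $|S|\ge2$. 2. $v_{\{j\}}F=F-\sum_{i<j}n_i-(K-j+1)n_j$ for all $j$, $v_{\{i,j\}}F=\min\{n_i,n_j\}$ for $i\ne j$, and $v_T=0$ whenever $|T|\ge3$. 3. For every $\bm d$, each signal $X_{T,\bm d}$ is the bitwise XOR, over $j\in T$, of pieces of the files $W_{d_j}$, where the piece of $W_{d_j}$ consists of bits that are not stored at user $j$ and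 are stored at all users in $T\setminus\{j\}$, and where, for each user $j$, no bit of $W_{d_j}$ occurs twice in the pieces for $j$ (over all signals $X_{T,\bm d}$ with $T\ni j$). 4. Every user recovers its requested file without error, for every $\bm d$ and every content of the library. 5. The load is $K-\sum_{j=1}^K(K-j+1)\,n_j/F$, which equals $R^*_{\mathfrak A}(\bm m)$ if all the $m_jF$ are integers, and is at most $R^*_{\mathfrak A}(\bm m)+\frac{K(K+1)}{2F}$ in any case. -/

import Mathlib

open Filter Finset

namespace CodedCaching

/-- A file of `F` bits. Bits are elements of `ZMod 2`, so that addition is XOR. -/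
abbrev File (F : ℕ) : Type := Fin F → ZMod 2

/-- A library of `N` files of `F` bits each. -/
abbrev Library (N F : ℕ) : Type := Fin N → File F

/-- The non-empty sets of users, which label the signals sent by the server. -/
abbrev UserSet (K : ℕ) : Type := {T : Finset (Fin K) // T.Nonempty}

/-- The allocation vectors of uncoded placement for the normalized cache sizes `m`:
`a S` is the fraction of every file that is stored exclusively at the users in `S`, and user `k`
has room for a fraction `m k` of every file. -/
def allocations {K : ℕ} (m : Fin K → ℝ) : Set (Finset (Fin K) → ℝ) :=
  {a | (∀ S, a S ∈ Set.Icc (0 : ℝ) 1) ∧ ∑ S, a S = 1 ∧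
    ∀ k, ∑ S with k ∈ S, a S ≤ m k}

/-- A caching scheme with uncoded placement and an arbitrary delivery scheme, for `K` users and
`N` files of `F` bits. -/
structure UncodedScheme (K N F : ℕ) where
  /-- `label l i` is the set of users that store bit `i` of file `l`. -/
  label : Fin N → Fin F → Finset (Fin K)
  /-- `v T` is the length of the signal sent to the users in `T`, normalized by the file size. -/
  v : UserSet K → ℝ
  v_nonneg : ∀ T, 0 ≤ v T
  /-- For every demand vector, the signal sent to the users in `T` is a function of the requested
  files. -/
  encode : (Fin K → Fin N) → (T : UserSet K) → (Fin K → File F) → (Fin ⌊v T * F⌋₊ → ZMod 2)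
  /-- User `k` decodes from all the signals and from the content of its own cache, that is from
  the bits of the library that are stored at `k`. -/
  decode : (Fin K → Fin N) → (k : Fin K) → ((T : UserSet K) → Fin ⌊v T * F⌋₊ → ZMod 2) →
    ({p : Fin N × Fin F // k ∈ label p.1 p.2} → ZMod 2) → File F

namespace UncodedScheme

variable {K N F : ℕ}

/-- The content of the cache of user `k`. -/
def cache (σ : UncodedScheme K N F) (k : Fin K) (W : Library N F) :
    {p : Fin N × Fin F // k ∈ σ.label p.1 p.2} → ZMod 2 :=
  fun p => W p.1.1 p.1.2

/-- The signals sent by the server when the demand vector is `d`. -/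
def signals (σ : UncodedScheme K N F) (d : Fin K → Fin N) (W : Library N F) :
    (T : UserSet K) → Fin ⌊σ.v T * F⌋₊ → ZMod 2 :=
  fun T => σ.encode d T (fun k => W (d k))

/-- The file that user `k` reconstructs. -/
def decoded (σ : UncodedScheme K N F) (d : Fin K → Fin N) (k : Fin K) (W : Library N F) :
    File F :=
  σ.decode d k (σ.signals d W) (σ.cache k W)

/-- The probability that user `k` does not recover its requested file, when the files are
independent and uniformly distributed. -/
noncomputable def errorProb (σ : UncodedScheme K N F) (d : Fin K → Fin N) (k : Fin K) : ℝ :=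
  (#{W : Library N F | σ.decoded d k W ≠ W (d k)} : ℝ) / Fintype.card (Library N F)

/-- The delivery load. -/
noncomputable def load (σ : UncodedScheme K N F) : ℝ := ∑ T, σ.v T

/-- Every file is split according to the allocation vector `a`: exactly `a S * F` of its bits are
stored exclusively at the users in `S`. -/
def HasAllocation (σ : UncodedScheme K N F) (a : Finset (Fin K) → ℝ) : Prop :=
  ∀ l S, (#{i | σ.label l i = S} : ℝ) = a S * F

/-- XOR delivery: the signal for `T` is the XOR, over the users `j ∈ T`, of pieces of the files
requested by the `j`'s. The piece for `j` consists of bits that are not stored at `j` and are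
stored at all the other users in `T`, and no bit is sent twice to the same user. For `T = {j}` the
signal is an uncoded piece of the file requested by `j`. -/
def IsXorDelivery (σ : UncodedScheme K N F) : Prop :=
  ∀ d : Fin K → Fin N, ∃ piece : (T : UserSet K) → Fin K → Fin ⌊σ.v T * F⌋₊ → Fin F,
    (∀ T, ∀ j ∈ T.1, ∀ t, j ∉ σ.label (d j) (piece T j t) ∧
      T.1 \ {j} ⊆ σ.label (d j) (piece T j t)) ∧
    (∀ j, Function.Injective
      (fun p : (T : {T : UserSet K // j ∈ T.1}) × Fin ⌊σ.v T.1 * F⌋₊ => piece p.1.1 j p.2)) ∧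
    ∀ (V : Fin K → File F) (T : UserSet K) (t : Fin ⌊σ.v T * F⌋₊),
      σ.encode d T V t = ∑ j ∈ T.1, V j (piece T j t)

end UncodedScheme

/-- The delivery load `R` is achievable with uncoded placement and any delivery scheme, for `N`
files and normalized cache sizes `m`. -/
def AchievableUncoded {K : ℕ} (N : ℕ) (m : Fin K → ℝ) (R : ℝ) : Prop :=
  ∀ ε > 0, ∀ᶠ F : ℕ in atTop, ∃ a ∈ allocations m, ∃ σ : UncodedScheme K N F,
    σ.HasAllocation a ∧ σ.load = R ∧ ∀ d k, σ.errorProb d k ≤ ε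

/-- The minimum worst-case delivery load with uncoded placement. -/
noncomputable def minLoadUncoded {K : ℕ} (N : ℕ) (m : Fin K → ℝ) : ℝ :=
  sInf {R | AchievableUncoded N m R}

end CodedCaching

/-! Converse: let the users request distinct files, which `K ≤ N` permits, and let them decode one
after another. When user `k` decodes, every bit of its cache either lies in a file recovered earlier
or is outside `acyclicBits`. So the signals and the bits outside `acyclicBits` determine a correctly
decoded library (`eq_of_signals_eq`). If at least half of all libraries are decoded by everybody,
counting gives `#acyclicBits ≤ load * F + 1`. By the union bound, users `0, …, k` store at most `∑ j
≤ k, m j * F` bits of the file of user `k`; summing over `k` gives `le_card_acyclicBits`, and the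
`1` is negligible for large `F`.

Achievability: the union bound is tight when no bit is stored twice, and `∑ m j ≤ 1` leaves room for
disjoint caches. Users `i` and `j` trade `min (n i) (n j)` bits by XOR, and each user gets what it
still lacks uncoded (`exists_pairwise_xor`). For sorted caches the load telescopes to the bound with
`n j / F` for `m j` (`sum_pairLength`); flooring costs `O(1 / F)`. -/

namespace CodedCaching

/-! ### Converse: successive decoding and counting -/

namespace UncodedScheme

variable {K N F : ℕ}

/-- The bits of requested files that are missing at the user who requests the file and at all
users with a smaller number. -/
def acyclicBits (σ : UncodedScheme K N F) (d : Fin K → Fin N) : Finset (Fin N × Fin F) :=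
  {p | ∃ k, d k = p.1 ∧ ∀ j ≤ k, j ∉ σ.label p.1 p.2}

/-- Libraries for which every user decodes correctly are determined by the signals and the bits
outside `acyclicBits`. -/
theorem eq_of_signals_eq (σ : UncodedScheme K N F) (d : Fin K → Fin N) {W W' : Library N F}
    (hW : ∀ k, σ.decoded d k W = W (d k)) (hW' : ∀ k, σ.decoded d k W' = W' (d k))
    (hs : σ.signals d W = σ.signals d W')
    (h : ∀ p ∉ σ.acyclicBits d, W p.1 p.2 = W' p.1 p.2) : W = W' := by
  have key : ∀ k, W (d k) = W' (d k) := by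
    intro k
    induction k using WellFoundedLT.induction with
    | ind k ih =>
      rw [← hW k, ← hW' k]
      have hc : σ.cache k W = σ.cache k W' := by
        funext ⟨p, hp⟩
        -- An acyclic bit cached at `k` must belong to the file of some `k' < k`, which is already
        -- determined.
        by_cases hA : p ∈ σ.acyclicBits d
        · obtain ⟨k', hk', hj⟩ := by simpa [acyclicBits] using hA
          have hlt : k' < k := by
            by_contra hle
            exact hj k (not_lt.mp hle) hp
          have := ih k' hlt
          rw [hk'] at this
          exact congrFun this p.2
        · exact h p hA
      simp only [decoded, hs, hc]
  funext l i
  by_cases hA : (l, i) ∈ σ.acyclicBits d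
  · obtain ⟨k, hk, -⟩ := by simpa [acyclicBits] using hA
    rw [← hk, key k]
  · exact h (l, i) hA

theorem card_library : Fintype.card (Library N F) = 2 ^ (N * F) := by
  simp [ZMod.card, ← pow_mul, mul_comm]

/-- `eq_of_signals_eq` makes the pair (signals, non-acyclic bits) injective on these libraries. -/
theorem card_decodable_mul_le (σ : UncodedScheme K N F) (d : Fin K → Fin N) :
    #{W : Library N F | ∀ k, σ.decoded d k W = W (d k)} * 2 ^ #(σ.acyclicBits d) ≤
      2 ^ (∑ T, ⌊σ.v T * F⌋₊) * 2 ^ (N * F) := by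
  classical
  let φ : Library N F → ((T : UserSet K) → Fin ⌊σ.v T * F⌋₊ → ZMod 2) ×
      ({p // p ∉ σ.acyclicBits d} → ZMod 2) :=
    fun W => (σ.signals d W, fun p => W p.1.1 p.1.2)
  have hφ : Set.InjOn φ
      (({W : Library N F | ∀ k, σ.decoded d k W = W (d k)} : Finset (Library N F)) :
        Set (Library N F)) := by
    intro W hW W' hW' h
    simp only [coe_filter, mem_univ, true_and, Set.mem_ofPred_eq] at hW hW'
    obtain ⟨hs, hb⟩ := Prod.mk.inj h
    exact σ.eq_of_signals_eq d hW hW' hs fun p hp => congrFun hb ⟨p, hp⟩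
  have hcard := Finset.card_le_card_of_injOn φ (fun _ _ => mem_univ _) hφ
  have hA : #(σ.acyclicBits d) ≤ N * F := by
    simpa using Finset.card_le_univ (σ.acyclicBits d)
  have hcompl : Fintype.card {p // p ∉ σ.acyclicBits d} = N * F - #(σ.acyclicBits d) := by
    rw [Fintype.card_subtype_compl]
    simp
  rw [Finset.card_univ, Fintype.card_prod, Fintype.card_pi, Fintype.card_pi] at hcard
  simp only [Fintype.card_pi, ZMod.card, prod_const, card_univ, Fintype.card_fin,
    prod_pow_eq_pow_sum, hcompl] at hcard
  calc _ ≤ _ := Nat.mul_le_mul_right _ hcard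
    _ = _ := by rw [mul_assoc, ← pow_add, Nat.sub_add_cancel hA]

theorem card_label_mem_le {σ : UncodedScheme K N F} {m : Fin K → ℝ} {a : Finset (Fin K) → ℝ}
    (ha : a ∈ allocations m) (hσ : σ.HasAllocation a) (l : Fin N) (j : Fin K) :
    (#{i | j ∈ σ.label l i} : ℝ) ≤ m j * F := by
  have h : #{i | j ∈ σ.label l i} =
      ∑ S with j ∈ S, #{i | σ.label l i = S} := by
    rw [Finset.card_eq_sum_card_fiberwise (f := σ.label l)
      (t := ({S | j ∈ S} : Finset (Finset (Fin K))))]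
    · refine Finset.sum_congr rfl fun S hS => ?_
      congr 1
      ext i
      simp only [mem_filter, mem_univ, true_and] at hS ⊢
      exact ⟨fun h => h.2, fun h => ⟨h ▸ hS, h⟩⟩
    · intro i hi
      simpa using hi
  rw [h, Nat.cast_sum, Finset.sum_congr rfl fun S _ => hσ l S, ← Finset.sum_mul]
  exact mul_le_mul_of_nonneg_right (ha.2.2 j) (Nat.cast_nonneg F)

theorem sum_sum_Iic (m : Fin K → ℝ) :
    ∑ k, ∑ j with j ≤ k, m j = ∑ j : Fin K, ((K : ℝ) - (j : ℕ)) * m j := by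
  simp only [Finset.sum_filter]
  rw [Finset.sum_comm]
  refine Finset.sum_congr rfl fun j _ => ?_
  rw [← Finset.sum_filter, Finset.sum_const, nsmul_eq_mul]
  have : ({k | j ≤ k} : Finset (Fin K)) = Finset.Ici j := by ext; simp
  rw [this, Fin.card_Ici, Nat.cast_sub j.2.le]

/-- Distinct demands make the contributions of the users disjoint; each is bounded below by a union
bound over the caches `j ≤ k`. Cache `j` is counted once for every `k ≥ j`, hence its weight. -/
theorem le_card_acyclicBits {σ : UncodedScheme K N F} {m : Fin K → ℝ}
    {a : Finset (Fin K) → ℝ} (ha : a ∈ allocations m) (hσ : σ.HasAllocation a)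
    {d : Fin K → Fin N} (hd : Function.Injective d) :
    (K - ∑ j : Fin K, ((K : ℝ) - (j : ℕ)) * m j) * F ≤ #(σ.acyclicBits d) := by
  classical
  have hfib : ∑ k, #{i | ∀ j ≤ k, j ∉ σ.label (d k) i} ≤ #(σ.acyclicBits d) := by
    rw [← Finset.card_sigma]
    refine Finset.card_le_card_of_injOn (fun p => (d p.1, p.2)) ?_ ?_
    · rintro ⟨k, i⟩ hp
      simp only [acyclicBits, coe_sigma, Set.mem_sigma_iff, coe_filter, mem_univ,
        true_and, Set.mem_ofPred_eq] at hp ⊢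
      exact ⟨k, rfl, hp.2⟩
    · rintro ⟨k, i⟩ - ⟨k', i'⟩ - h
      obtain ⟨h1, h2⟩ := Prod.mk.inj h
      obtain rfl := hd h1
      obtain rfl : i = i' := h2
      rfl
  have hk : ∀ k, (F : ℝ) - ∑ j with j ≤ k, m j * F ≤
      #{i | ∀ j ≤ k, j ∉ σ.label (d k) i} := by
    intro k
    have h1 : F ≤ #{i | ∀ j ≤ k, j ∉ σ.label (d k) i} +
        ∑ j with j ≤ k, #{i | j ∈ σ.label (d k) i} := by
      calc F = #(univ : Finset (Fin F)) := by simp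
        _ ≤ #(({i | ∀ j ≤ k, j ∉ σ.label (d k) i} : Finset (Fin F)) ∪
            ({j | j ≤ k} : Finset (Fin K)).biUnion fun j => {i | j ∈ σ.label (d k) i}) := by
          refine Finset.card_le_card fun i _ => ?_
          simp only [mem_union, mem_filter, mem_univ, true_and, mem_biUnion]
          by_cases h : ∀ j ≤ k, j ∉ σ.label (d k) i
          · exact Or.inl h
          · push Not at h
            exact Or.inr h
        _ ≤ _ := (Finset.card_union_le _ _).trans
            (Nat.add_le_add_left Finset.card_biUnion_le _)
    have h2 : (F : ℝ) ≤ #{i | ∀ j ≤ k, j ∉ σ.label (d k) i} +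
        ∑ j with j ≤ k, (#{i | j ∈ σ.label (d k) i} : ℝ) := by exact_mod_cast h1
    have h3 := Finset.sum_le_sum fun j (_ : j ∈ ({j | j ≤ k} : Finset (Fin K))) =>
      card_label_mem_le ha hσ (d k) j
    linarith
  calc (K - ∑ j : Fin K, ((K : ℝ) - (j : ℕ)) * m j) * F
      = ∑ k : Fin K, ((F : ℝ) - ∑ j with j ≤ k, m j * F) := by
        rw [← sum_sum_Iic, Finset.sum_sub_distrib, sub_mul, Finset.sum_mul]
        simp [Finset.sum_mul]
    _ ≤ ∑ k, (#{i | ∀ j ≤ k, j ∉ σ.label (d k) i} : ℝ) := Finset.sum_le_sum fun k _ => hk k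
    _ ≤ _ := by exact_mod_cast hfib

/-- If every user fails with a probability of at most `1 / (2 * (K + 1))`, then at least half of
all libraries are decoded correctly by everybody. -/
theorem card_library_le (σ : UncodedScheme K N F) (d : Fin K → Fin N)
    (h : ∀ k, σ.errorProb d k ≤ 1 / (2 * (K + 1))) :
    (2 : ℝ) ^ (N * F) ≤ 2 * #{W : Library N F | ∀ k, σ.decoded d k W = W (d k)} := by
  classical
  have hpos : (0 : ℝ) < 2 ^ (N * F) := by positivity
  have hc : (Fintype.card (Library N F) : ℝ) = 2 ^ (N * F) := by
    rw [card_library]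
    norm_cast
  have h1 : 2 ^ (N * F) ≤ #{W : Library N F | ∀ k, σ.decoded d k W = W (d k)} +
      ∑ k, #{W : Library N F | σ.decoded d k W ≠ W (d k)} := by
    calc 2 ^ (N * F) = #(univ : Finset (Library N F)) := by
          rw [Finset.card_univ, card_library]
      _ ≤ #(({W | ∀ k, σ.decoded d k W = W (d k)} : Finset (Library N F)) ∪
            univ.biUnion fun k => {W : Library N F | σ.decoded d k W ≠ W (d k)}) := by
          refine Finset.card_le_card fun W _ => ?_
          simp only [mem_union, mem_filter, mem_univ, true_and, mem_biUnion]
          by_cases h : ∀ k, σ.decoded d k W = W (d k)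
          · exact Or.inl h
          · push Not at h
            exact Or.inr h
      _ ≤ _ := (Finset.card_union_le _ _).trans
            (Nat.add_le_add_left Finset.card_biUnion_le _)
  have h2 : (2 : ℝ) ^ (N * F) ≤ #{W : Library N F | ∀ k, σ.decoded d k W = W (d k)} +
      ∑ k, (#{W : Library N F | σ.decoded d k W ≠ W (d k)} : ℝ) := by exact_mod_cast h1
  have h3 : ∑ k, (#{W : Library N F | σ.decoded d k W ≠ W (d k)} : ℝ) ≤
      ∑ _k : Fin K, 1 / (2 * ((K : ℝ) + 1)) * 2 ^ (N * F) := by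
    refine Finset.sum_le_sum fun k _ => ?_
    have := h k
    rw [errorProb, hc, div_le_iff₀ hpos] at this
    exact this
  have h4 : ∑ _k : Fin K, 1 / (2 * ((K : ℝ) + 1)) * (2 : ℝ) ^ (N * F) ≤ 2 ^ (N * F) / 2 := by
    rw [Finset.sum_const, Finset.card_univ, Fintype.card_fin, nsmul_eq_mul, ← mul_assoc]
    have : (K : ℝ) * (1 / (2 * ((K : ℝ) + 1))) ≤ 1 / 2 := by
      rw [mul_one_div, div_le_div_iff₀ (by positivity) (by norm_num)]
      linarith
    nlinarith
  linarith

/-- The extra bit pays for the factor 2 lost by restricting to correctly decoded libraries. -/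
theorem le_load_mul_add_one {σ : UncodedScheme K N F} {m : Fin K → ℝ}
    {a : Finset (Fin K) → ℝ} (ha : a ∈ allocations m) (hσ : σ.HasAllocation a)
    {d : Fin K → Fin N} (hd : Function.Injective d)
    (h : ∀ k, σ.errorProb d k ≤ 1 / (2 * (K + 1))) :
    (K - ∑ j : Fin K, ((K : ℝ) - (j : ℕ)) * m j) * F ≤ σ.load * F + 1 := by
  have h1 := σ.card_library_le d h
  have h2 : (#{W : Library N F | ∀ k, σ.decoded d k W = W (d k)} : ℝ) *
      2 ^ #(σ.acyclicBits d) ≤ 2 ^ (∑ T, ⌊σ.v T * F⌋₊) * 2 ^ (N * F) := by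
    exact_mod_cast σ.card_decodable_mul_le d
  have h3 : (2 : ℝ) ^ #(σ.acyclicBits d) ≤ 2 ^ (∑ T, ⌊σ.v T * F⌋₊ + 1) := by
    have hpos : (0 : ℝ) < 2 ^ (N * F) := by positivity
    refine le_of_mul_le_mul_left ?_ hpos
    calc (2 : ℝ) ^ (N * F) * 2 ^ #(σ.acyclicBits d)
        ≤ 2 * #{W : Library N F | ∀ k, σ.decoded d k W = W (d k)} *
          2 ^ #(σ.acyclicBits d) := mul_le_mul_of_nonneg_right h1 (by positivity)
      _ ≤ 2 * (2 ^ (∑ T, ⌊σ.v T * F⌋₊) * 2 ^ (N * F)) := by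
        rw [mul_assoc]
        exact mul_le_mul_of_nonneg_left h2 (by norm_num)
      _ = _ := by ring
  have h4 : #(σ.acyclicBits d) ≤ ∑ T, ⌊σ.v T * F⌋₊ + 1 :=
    (pow_le_pow_iff_right₀ (by norm_num : (1 : ℝ) < 2)).mp h3
  have h5 : ((∑ T, ⌊σ.v T * F⌋₊ : ℕ) : ℝ) ≤ σ.load * F := by
    rw [load, Finset.sum_mul, Nat.cast_sum]
    exact Finset.sum_le_sum fun T _ =>
      Nat.floor_le (mul_nonneg (σ.v_nonneg T) (Nat.cast_nonneg F))
  have h6 : (#(σ.acyclicBits d) : ℝ) ≤ (∑ T, ⌊σ.v T * F⌋₊ : ℕ) + 1 := by exact_mod_cast h4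
  linarith [le_card_acyclicBits ha hσ hd]

end UncodedScheme

theorem AchievableUncoded.le {K N : ℕ} (hKN : K ≤ N) {m : Fin K → ℝ} {R : ℝ}
    (hR : AchievableUncoded N m R) :
    K - ∑ j : Fin K, ((K : ℝ) - (j : ℕ)) * m j ≤ R := by
  by_contra! hlt
  -- Writing `K + 1` instead of `K` keeps the tolerance positive for `K = 0`. The file size is then
  -- taken so large that the gap times `F` exceeds the one spare bit.
  have hev := hR (1 / (2 * (K + 1))) (by positivity)
  obtain ⟨F, ⟨a, ha, σ, hσ, hload, herr⟩, hF⟩ := (hev.and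
    ((tendsto_natCast_atTop_atTop (R := ℝ)).eventually_gt_atTop
      (1 / (K - ∑ j : Fin K, ((K : ℝ) - (j : ℕ)) * m j - R)))).exists
  have h := UncodedScheme.le_load_mul_add_one ha hσ (Fin.castLE_injective hKN)
    (herr (Fin.castLE hKN))
  rw [hload] at h
  rw [div_lt_iff₀ (by linarith)] at hF
  nlinarith

end CodedCaching

/-! ### Achievability: decoding XOR signals -/

namespace CodedCaching

variable {K N F : ℕ}

theorem mem_allocations_of_label {m : Fin K → ℝ} (hF : 1 ≤ F)
    (label : Fin F → Finset (Fin K)) (h : ∀ k, (#{i | k ∈ label i} : ℝ) ≤ m k * F) :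
    (fun S => (#{i | label i = S} : ℝ) / F) ∈ allocations m := by
  have hF0 : (0 : ℝ) < F := by exact_mod_cast hF
  refine ⟨fun S => ⟨by positivity, ?_⟩, ?_, fun k => ?_⟩
  · rw [div_le_one hF0]
    exact_mod_cast (Finset.card_le_univ _).trans_eq (Fintype.card_fin F)
  · rw [← Finset.sum_div, div_eq_one_iff_eq hF0.ne', ← Nat.cast_sum,
      ← Finset.card_eq_sum_card_fiberwise fun _ _ => mem_coe.mpr (mem_univ _)]
    simp
  · rw [← Finset.sum_div, div_le_iff₀ hF0]
    refine le_trans ?_ (h k)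
    rw [← Nat.cast_sum, Nat.cast_le,
      Finset.card_eq_sum_card_fiberwise (f := label) (s := {i | k ∈ label i})
      (t := ({S | k ∈ S} : Finset (Finset (Fin K)))) fun i hi => by simpa using hi]
    refine Finset.sum_le_sum fun S hS => Finset.card_le_card fun i hi => ?_
    simp only [mem_filter, mem_univ, true_and] at hS hi ⊢
    exact ⟨hi ▸ hS, hi⟩

namespace UncodedScheme

/-- XOR delivery decodes without error if the pieces for every user cover the bits that are not
stored at that user. -/
theorem exists_of_pieces (hF : 1 ≤ F) (label : Fin F → Finset (Fin K)) (len : UserSet K → ℕ)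
    (piece : (T : UserSet K) → Fin K → Fin (len T) → Fin F)
    (hmem : ∀ T, ∀ j ∈ T.1, ∀ t, j ∉ label (piece T j t) ∧ T.1 \ {j} ⊆ label (piece T j t))
    (hinj : ∀ j, Function.Injective
      (fun p : (T : {T : UserSet K // j ∈ T.1}) × Fin (len T.1) => piece p.1.1 j p.2))
    (hcov : ∀ j x, j ∉ label x → ∃ T : UserSet K, j ∈ T.1 ∧ ∃ t, piece T j t = x) :
    ∃ σ : UncodedScheme K N F, (∀ l, σ.label l = label) ∧ (∀ T, σ.v T * F = len T) ∧
      σ.IsXorDelivery ∧ ∀ d k W, σ.decoded d k W = W (d k) := by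
  classical
  have hF0 : (F : ℝ) ≠ 0 := by positivity
  have hv : ∀ T, (len T : ℝ) / F * F = len T := fun T => div_mul_cancel₀ _ hF0
  have hfl : ∀ T, ⌊(len T : ℝ) / F * F⌋₊ = len T := fun T => by rw [hv, Nat.floor_natCast]
  let enc : (T : UserSet K) → (Fin K → File F) → (Fin ⌊(len T : ℝ) / F * F⌋₊ → ZMod 2) :=
    fun T V t => ∑ j ∈ T.1, V j (piece T j (Fin.cast (hfl T) t))
  let σ : UncodedScheme K N F :=
    { label := fun _ => label
      v := fun T => len T / F
      v_nonneg := fun T => by positivity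
      encode := fun _ => enc
      -- Decode to any library consistent with signals and cache. The true library is consistent, so
      -- the default `0` does not occur on actual transmissions.
      decode := fun d k s c => if h : ∃ W : Library N F, (fun T => enc T fun k => W (d k)) = s ∧
          (fun p : {p : Fin N × Fin F // k ∈ label p.2} => W p.1.1 p.1.2) = c
        then h.choose (d k) else 0 }
  refine ⟨σ, fun _ => rfl, hv, ?_, ?_⟩
  · refine fun d => ⟨fun T j t => piece T j (Fin.cast (hfl T) t),
      fun T j hj t => hmem T j hj _, ?_, fun V T t => rfl⟩
    rintro j ⟨T, t⟩ ⟨T', t'⟩ h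
    have h' := hinj j (a₁ := ⟨T, Fin.cast (hfl T.1) t⟩) (a₂ := ⟨T', Fin.cast (hfl T'.1) t'⟩) h
    obtain ⟨rfl, h'⟩ := Sigma.mk.inj h'
    rw [Sigma.mk.injEq]
    exact ⟨rfl, heq_of_eq (Fin.cast_injective _ (eq_of_heq h'))⟩
  · intro d k W
    have hex : ∃ W' : Library N F, (fun T => enc T fun k => W' (d k)) = σ.signals d W ∧
        (fun p : {p : Fin N × Fin F // k ∈ label p.2} => W' p.1.1 p.1.2) = σ.cache k W :=
      ⟨W, rfl, rfl⟩
    have hdec : σ.decoded d k W = hex.choose (d k) := dif_pos hex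
    obtain ⟨hs, hc⟩ := hex.choose_spec
    rw [hdec]
    generalize hex.choose = W' at hs hc
    have hc' : ∀ l x, k ∈ label x → W' l x = W l x := fun l x hx =>
      congrFun hc ⟨(l, x), hx⟩
    funext x
    by_cases hx : k ∈ label x
    · exact hc' _ _ hx
    · obtain ⟨T, hkT, t, rfl⟩ := hcov k x hx
      have h := congrFun (congrFun hs T) (Fin.cast (hfl T).symm t)
      change ∑ j ∈ T.1, W' (d j) (piece T j t) = ∑ j ∈ T.1, W (d j) (piece T j t) at h
      -- All other summands are cached at `k`, so they agree for both libraries and cancel.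
      rw [← Finset.add_sum_erase _ _ hkT, ← Finset.add_sum_erase _ _ hkT] at h
      rw [Finset.sum_congr rfl fun j hj => ?_] at h
      · exact add_right_cancel h
      · obtain ⟨hjk, hj⟩ := Finset.mem_erase.mp hj
        exact hc' _ _ ((hmem T j hj t).2 (by simp [hkT, hjk.symm]))

/-! ### The pairwise XOR scheme and its load -/

/-- The length of the signals of the pairwise XOR scheme, when `n j` bits of every file are
stored at user `j` only. -/
def pairLength (n : Fin K → ℕ) (F : ℕ) (T : UserSet K) : ℕ :=
  if T.1.card = 1 then ∑ j ∈ T.1, (F - ∑ i, min (n i) (n j))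
  else if T.1.card = 2 then T.1.inf' T.2 n else 0

theorem pairLength_singleton (n : Fin K → ℕ) (j : Fin K) :
    pairLength n F ⟨{j}, singleton_nonempty j⟩ = F - ∑ i, min (n i) (n j) := by
  simp [pairLength]

theorem pairLength_pair (n : Fin K → ℕ) {i j : Fin K} (h : i ≠ j) :
    pairLength n F ⟨{i, j}, insert_nonempty i {j}⟩ = min (n i) (n j) := by
  simp [pairLength, card_pair h, Finset.inf'_insert]

theorem pairLength_of_three_le_card (n : Fin K → ℕ) {T : UserSet K} (h : 3 ≤ T.1.card) :
    pairLength n F T = 0 := by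
  rw [pairLength, if_neg (by omega), if_neg (by omega)]

/-- The minimum is `n i` before `j` and `n j` for the `K - j` users from `j` on. -/
theorem sum_min_eq {n : Fin K → ℕ} (hn : Monotone n) (j : Fin K) :
    (∑ i, min (n i) (n j) : ℕ) =
      ∑ i with i < j, (n i : ℝ) + ((K : ℝ) - (j : ℕ)) * n j := by
  rw [← Finset.sum_filter_add_sum_filter_not _ (fun i => i < j), Nat.cast_add, Nat.cast_sum,
    Nat.cast_sum]
  congr 1
  · refine Finset.sum_congr rfl fun i hi => ?_
    rw [min_eq_left (hn (mem_filter.mp hi).2.le)]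
  · rw [Finset.sum_congr rfl fun i hi => by
      rw [min_eq_right (hn (not_lt.mp (mem_filter.mp hi).2))]]
    have : ({i | ¬ i < j} : Finset (Fin K)) = Finset.Ici j := by ext; simp
    rw [this, Finset.sum_const, nsmul_eq_mul, Fin.card_Ici, Nat.cast_sub j.2.le]

/-- Pairwise XOR delivery for the placement that stores `n j` bits of every file at user `j`
only. -/
theorem exists_pairwise_xor (hF : 1 ≤ F) {n : Fin K → ℕ} (hn : ∑ j, n j ≤ F) :
    ∃ label : Fin F → Finset (Fin K), (∀ j, #{i | j ∈ label i} = n j) ∧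
      (∀ i, (label i).card ≤ 1) ∧
      ∃ σ : UncodedScheme K N F, (∀ l, σ.label l = label) ∧
        (∀ T, σ.v T * F = pairLength n F T) ∧
        σ.IsXorDelivery ∧ ∀ d k W, σ.decoded d k W = W (d k) := by
  classical
  -- `e` lays out disjoint blocks of `n j` bits, one block per user.
  obtain ⟨e⟩ : Nonempty ((Σ j, Fin (n j)) ↪ Fin F) :=
    Function.Embedding.nonempty_of_card_le (by simpa using hn)
  let label : Fin F → Finset (Fin K) := fun x => {j | ∃ t, e ⟨j, t⟩ = x}
  have hlabel : ∀ j x, j ∈ label x ↔ ∃ t, e ⟨j, t⟩ = x := fun j x => by simp [label]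
  have hlabel_e : ∀ j k t, j ∈ label (e ⟨k, t⟩) ↔ j = k := by
    intro j k t
    rw [hlabel]
    constructor
    · rintro ⟨s, hs⟩
      exact (Sigma.mk.inj (e.injective hs)).1
    · rintro rfl
      exact ⟨t, rfl⟩
  -- The bits that reach user `j` by its cache or by a XOR.
  let B : Fin K → Finset (Fin F) := fun j =>
    univ.image fun p : Σ i, Fin (min (n i) (n j)) =>
      e ⟨p.1, Fin.castLE (min_le_left _ _) p.2⟩
  have hB : ∀ j x, x ∈ B j ↔ ∃ i, ∃ t : Fin (n i), t.1 < n j ∧ e ⟨i, t⟩ = x := by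
    intro j x
    simp only [B, mem_image, mem_univ, true_and, Sigma.exists]
    constructor
    · rintro ⟨i, t, h⟩
      exact ⟨i, _, t.2.trans_le (min_le_right _ _), h⟩
    · rintro ⟨i, t, ht, h⟩
      exact ⟨i, ⟨t, lt_min t.2 ht⟩, h⟩
  have hBcard : ∀ j, #(B j)ᶜ = F - ∑ i, min (n i) (n j) := by
    intro j
    rw [Finset.card_compl, Fintype.card_fin, Finset.card_image_of_injective]
    · simp
    · rintro ⟨i, t⟩ ⟨i', t'⟩ h
      obtain ⟨rfl, h⟩ := Sigma.mk.inj (e.injective h)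
      rw [Sigma.mk.injEq]
      exact ⟨rfl, heq_of_eq (Fin.castLE_injective _ (eq_of_heq h))⟩
  let g : (j : Fin K) → Fin (F - ∑ i, min (n i) (n j)) ≃ {x // x ∈ (B j)ᶜ} := fun j =>
    ((B j)ᶜ.equivFinOfCardEq (hBcard j)).symm
  have hg : ∀ j t, (g j t).1 ∉ B j := fun j t => mem_compl.mp (g j t).2
  have hpiece : ∀ (T : UserSet K) (j : Fin K) (t : Fin (pairLength n F T)), ∃ x, j ∈ T.1 →
      (T.1 = {j} ∧ ∃ h, x = (g j ⟨t.1, h⟩).1) ∨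
      ∃ i, i ≠ j ∧ T.1 = {i, j} ∧ t.1 < n j ∧ ∃ h, x = e ⟨i, ⟨t.1, h⟩⟩ := by
    rintro ⟨T, hT⟩ j t
    by_cases hj : j ∈ T
    · rcases lt_or_ge T.card 3 with h3 | h3
      · have hpos := hT.card_pos
        interval_cases hc : T.card
        · obtain ⟨j', rfl⟩ := Finset.card_eq_one.mp hc
          obtain rfl := mem_singleton.mp hj
          exact ⟨_, fun _ => Or.inl ⟨rfl, by simpa [pairLength] using t.2, rfl⟩⟩
        · have ⟨i, hi, hij⟩ : ∃ i ∈ T, i ≠ j :=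
            Finset.exists_mem_ne (by omega) j
          obtain rfl : T = {i, j} := by
            refine (Finset.eq_of_subset_of_card_le ?_ ?_).symm
            · simp [Finset.insert_subset_iff, hi, hj]
            · rw [hc, card_pair hij]
          have ht := lt_min_iff.mp (t.2.trans_eq (pairLength_pair n hij))
          exact ⟨_, fun _ => Or.inr ⟨i, hij, rfl, ht.2, ht.1, rfl⟩⟩
      · exact absurd (t.2.trans_eq (pairLength_of_three_le_card n h3)) (Nat.not_lt_zero _)
    -- A junk bit for users outside `T`, available since `1 ≤ F`.
    · exact ⟨⟨0, hF⟩, fun h => absurd h hj⟩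
  choose piece hpiece using hpiece
  refine ⟨label, fun j => ?_, fun x => ?_,
    exists_of_pieces hF label (pairLength n F) piece ?_ ?_ ?_⟩
  · rw [← Fintype.card_fin (n j), ← Finset.card_univ]
    refine (Finset.card_nbij (fun t => e ⟨j, t⟩) (fun t _ => ?_) ?_ ?_).symm
    · simp [hlabel_e]
    · intro t _ t' _ h
      exact eq_of_heq (Sigma.mk.inj (e.injective h)).2
    · intro x hx
      obtain ⟨t, ht⟩ := (hlabel j x).mp (by simpa using hx)
      exact ⟨t, by simp, ht⟩
  · refine Finset.card_le_one.mpr fun i hi j hj => ?_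
    obtain ⟨t, rfl⟩ := (hlabel i x).mp hi
    exact ((hlabel_e j i t).mp hj).symm
  · intro T j hj t
    rcases hpiece T j t hj with ⟨hT, h, hx⟩ | ⟨i, hij, hT, -, h, hx⟩
    · refine ⟨fun hmem => hg j ⟨t.1, h⟩ ?_, by simp [hT]⟩
      rw [hx, hlabel] at hmem
      obtain ⟨s, hs⟩ := hmem
      exact (hB _ _).mpr ⟨j, s, s.2, hs⟩
    · rw [hx, hlabel_e, hT]
      refine ⟨hij.symm, fun k hk => ?_⟩
      rw [hlabel_e]
      simp only [Finset.mem_sdiff, mem_insert, mem_singleton] at hk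
      tauto
  · rintro j ⟨⟨T, hj⟩, t⟩ ⟨⟨T', hj'⟩, t'⟩ heq
    replace heq : piece T j t = piece T' j t' := heq
    suffices h : T = T' ∧ t.1 = t'.1 by
      obtain ⟨rfl, h⟩ := h
      rw [Fin.ext h]
    rw [Subtype.ext_iff]
    -- Uncoded bits avoid `B j` and XORed bits lie in it, so mixed cases are impossible; in a XOR,
    -- the bit reveals its owner `i`, hence `T`.
    rcases hpiece T j t hj with ⟨hT, h, hx⟩ | ⟨i, hij, hT, htj, h, hx⟩ <;>
    rcases hpiece T' j t' hj' with ⟨hT', h', hx'⟩ | ⟨i', hij', hT', htj', h', hx'⟩ <;>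
    rw [hx, hx'] at heq
    · refine ⟨hT.trans hT'.symm, ?_⟩
      exact Fin.ext_iff.mp ((g j).injective (Subtype.ext heq))
    · exact absurd ((hB _ _).mpr ⟨i', _, htj', heq.symm⟩) (hg _ _)
    · exact absurd ((hB _ _).mpr ⟨i, _, htj, heq⟩) (hg _ _)
    · obtain ⟨rfl, h2⟩ := Sigma.mk.inj (e.injective heq)
      exact ⟨hT.trans hT'.symm, Fin.ext_iff.mp (eq_of_heq h2)⟩
  · intro j x hx
    by_cases hxB : x ∈ B j
    · obtain ⟨i, s, hs, rfl⟩ := (hB j x).mp hxB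
      have hij : i ≠ j := fun h => hx ((hlabel_e j i s).mpr h.symm)
      have hj : j ∈ ({i, j} : Finset (Fin K)) := by simp
      refine ⟨⟨{i, j}, insert_nonempty i {j}⟩, hj,
        ⟨s.1, by rw [pairLength_pair n hij]; exact lt_min s.2 hs⟩, ?_⟩
      rcases hpiece ⟨{i, j}, insert_nonempty i {j}⟩ j
        ⟨s.1, by rw [pairLength_pair n hij]; exact lt_min s.2 hs⟩ hj with
        ⟨hT, -⟩ | ⟨i', hij', hT, -, h, hx⟩
      · have : i ∈ ({j} : Finset (Fin K)) := by rw [← hT]; simp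
        exact absurd (mem_singleton.mp this) hij
      · have : i ∈ ({i', j} : Finset (Fin K)) := by rw [← hT]; simp
        obtain rfl : i = i' := by simpa [hij] using this
        rw [hx]
    · have hj : j ∈ ({j} : Finset (Fin K)) := by simp
      obtain ⟨s, hs⟩ := (g j).surjective ⟨x, mem_compl.mpr hxB⟩
      refine ⟨⟨{j}, singleton_nonempty j⟩, hj, ⟨s.1, by rw [pairLength_singleton]; exact s.2⟩, ?_⟩
      rcases hpiece ⟨{j}, singleton_nonempty j⟩ j
        ⟨s.1, by rw [pairLength_singleton]; exact s.2⟩ hj with ⟨-, h, hx⟩ | ⟨i, hij, hT, -⟩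
      · rw [hx, Fin.eta, hs]
      · have : i ∈ ({j} : Finset (Fin K)) := by
          change i ∈ (⟨{j}, singleton_nonempty j⟩ : UserSet K).1
          rw [hT]; simp
        exact absurd (mem_singleton.mp this) hij

/-- With each pair charged to its larger index `j`, the XORs cost `∑ i < j, n i`, which cancels the
same sum in `sum_min_eq`. -/
theorem sum_pairLength {n : Fin K → ℕ} (hn : Monotone n) (hsum : ∑ j, n j ≤ F) :
    ((∑ T, pairLength n F T : ℕ) : ℝ) =
      K * F - ∑ j : Fin K, ((K : ℝ) - (j : ℕ)) * n j := by
  have hle : ∀ j, ∑ i, min (n i) (n j) ≤ F := fun j =>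
    (Finset.sum_le_sum fun i _ => min_le_left _ _).trans hsum
  have h1 : ∑ T : UserSet K with T.1.card = 1, pairLength n F T =
      ∑ j, (F - ∑ i, min (n i) (n j)) := by
    refine (Finset.sum_nbij (fun j => (⟨{j}, singleton_nonempty j⟩ : UserSet K))
      (fun j _ => by simp) (fun i _ j _ h => by simpa using h) ?_
      fun j _ => (pairLength_singleton n j).symm).symm
    rintro ⟨T, hT⟩ h
    obtain ⟨j, rfl⟩ := Finset.card_eq_one.mp (by simpa using h)
    exact ⟨j, by simp, rfl⟩
  have h2 : ∑ T : UserSet K with ¬ T.1.card = 1, pairLength n F T =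
      ∑ j, ∑ i with i < j, n i := by
    rw [Finset.sum_sigma']
    symm
    refine Finset.sum_of_injOn
      (fun p => (⟨{p.2, p.1}, insert_nonempty p.2 {p.1}⟩ : UserSet K)) ?_ ?_ ?_ ?_
    · rintro ⟨j, i⟩ h ⟨j', i'⟩ h' heq
      simp only [coe_sigma, coe_univ, coe_filter, mem_univ, true_and, Set.mem_sigma_iff,
        Set.mem_univ, Set.mem_ofPred_eq] at h h'
      have heq : ({i, j} : Finset (Fin K)) = {i', j'} := Subtype.ext_iff.mp heq
      have e1 : i ∈ ({i', j'} : Finset (Fin K)) := heq ▸ by simp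
      have e2 : j ∈ ({i', j'} : Finset (Fin K)) := heq ▸ by simp
      have e3 : i' ∈ ({i, j} : Finset (Fin K)) := heq ▸ by simp
      simp only [mem_insert, mem_singleton] at e1 e2 e3
      have : i = i' ∧ j = j' := by
        simp only [Fin.ext_iff, Fin.lt_def] at *
        omega
      rw [this.1, this.2]
    · rintro ⟨j, i⟩ h
      simp only [coe_sigma, coe_univ, coe_filter, mem_univ, true_and, Set.mem_sigma_iff,
        Set.mem_univ, Set.mem_ofPred_eq] at h ⊢
      rw [card_pair h.ne]
      norm_num
    · rintro ⟨T, hT⟩ h1 h2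
      have hc1 : T.card ≠ 1 := by simpa using h1
      by_cases hc2 : T.card = 2
      · obtain ⟨i, j, hij, rfl⟩ := Finset.card_eq_two.mp hc2
        refine absurd ?_ h2
        rcases hij.lt_or_gt with h | h
        · exact ⟨⟨j, i⟩, by simpa using h, rfl⟩
        · exact ⟨⟨i, j⟩, by simpa using h, Subtype.ext (Finset.pair_comm _ _)⟩
      · simp [pairLength, hc1, hc2]
    · rintro ⟨j, i⟩ h
      have h : i < j := by simpa using h
      simp only
      rw [pairLength_pair n h.ne, min_eq_left (hn h.le)]
  rw [← Finset.sum_filter_add_sum_filter_not univ (fun T : UserSet K => T.1.card = 1), h1, h2,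
    Nat.cast_add, Nat.cast_sum, Nat.cast_sum, ← Finset.sum_add_distrib]
  have : ∀ j : Fin K, ((F - ∑ i, min (n i) (n j) : ℕ) : ℝ) +
      ((∑ i with i < j, n i : ℕ) : ℝ) = F - ((K : ℝ) - (j : ℕ)) * n j := by
    intro j
    rw [Nat.cast_sub (hle j), sum_min_eq hn j, Nat.cast_sum]
    ring
  rw [Finset.sum_congr rfl fun j _ => this j, Finset.sum_sub_distrib]
  simp

/-- A scheme can be padded to any larger signal lengths. -/
theorem exists_pad (σ : UncodedScheme K N F) {v' : UserSet K → ℝ} (hv : ∀ T, σ.v T ≤ v' T) :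
    ∃ τ : UncodedScheme K N F, τ.label = σ.label ∧ τ.v = v' ∧
      ∀ d k W, τ.decoded d k W = σ.decoded d k W := by
  have hfl : ∀ T, ⌊σ.v T * F⌋₊ ≤ ⌊v' T * F⌋₊ := fun T =>
    Nat.floor_le_floor (mul_le_mul_of_nonneg_right (hv T) (Nat.cast_nonneg F))
  refine ⟨{ label := σ.label
            v := v'
            v_nonneg := fun T => (σ.v_nonneg T).trans (hv T)
            encode := fun d T V t => if h : t.1 < ⌊σ.v T * F⌋₊ then σ.encode d T V ⟨t, h⟩ else 0
            decode := fun d k s c => σ.decode d k (fun T t => s T (Fin.castLE (hfl T) t)) c },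
    rfl, rfl, fun d k W => ?_⟩
  change σ.decode d k _ _ = σ.decode d k _ _
  congr 1
  funext T t
  simp [signals]

end UncodedScheme

end CodedCaching

/-! ### Rounding, padding and the infimum -/

namespace CodedCaching

variable {K N F : ℕ}

/-- The floors of the scaled cache sizes leave a loss of at most `K * (K + 1) / (2 * F)`. -/
theorem load_le_of_floor (hF : 1 ≤ F) (m : Fin K → ℝ) :
    K - ∑ j : Fin K, ((K : ℝ) - (j : ℕ)) * (⌊m j * F⌋₊ / F) ≤
      K - ∑ j : Fin K, ((K : ℝ) - (j : ℕ)) * m j + K * (K + 1) / (2 * F) := by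
  have hF0 : (0 : ℝ) < F := by exact_mod_cast hF
  have hterm : ∀ j : Fin K, ((K : ℝ) - (j : ℕ)) * m j ≤
      ((K : ℝ) - (j : ℕ)) * (⌊m j * F⌋₊ / F) + ((K : ℝ) - (j : ℕ)) / F := by
    intro j
    have hj : (0 : ℝ) ≤ (K : ℝ) - (j : ℕ) := sub_nonneg.mpr (by exact_mod_cast j.2.le)
    have h : m j ≤ (⌊m j * F⌋₊ + 1) / F := by
      rw [le_div_iff₀ hF0]
      exact (Nat.lt_floor_add_one _).le
    calc _ ≤ ((K : ℝ) - (j : ℕ)) * ((⌊m j * F⌋₊ + 1) / F) := mul_le_mul_of_nonneg_left h hj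
      _ = _ := by ring
  have hsum := Finset.sum_le_sum fun j (_ : j ∈ univ) => hterm j
  have hgauss : ∀ k : ℕ, ∑ j : Fin k, ((k : ℝ) - (j : ℕ)) = k * (k + 1) / 2 := by
    intro k
    induction k with
    | zero => simp
    | succ k ih =>
      rw [Fin.sum_univ_succ]
      have : ∀ j : Fin k, ((k + 1 : ℕ) : ℝ) - (j.succ : ℕ) = (k : ℝ) - (j : ℕ) := by
        intro j
        push_cast [Fin.val_succ]
        ring
      rw [Finset.sum_congr rfl fun j _ => this j, ih]
      push_cast [Fin.val_zero]
      ring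
  rw [Finset.sum_add_distrib, ← Finset.sum_div, hgauss, div_div] at hsum
  linarith

/-- Achievability asks for load exactly `R`; the slack is padded onto one singleton signal, which
requires a user. -/
theorem achievableUncoded_of_schemes {m : Fin K → ℝ} {R : ℝ} (hK : 0 < K)
    (h : ∀ᶠ F : ℕ in atTop, ∃ a ∈ allocations m, ∃ σ : UncodedScheme K N F,
      σ.HasAllocation a ∧ σ.load ≤ R ∧ ∀ d k W, σ.decoded d k W = W (d k)) :
    AchievableUncoded N m R := by
  intro ε hε
  filter_upwards [h] with F ⟨a, ha, σ, hσ, hload, hdec⟩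
  let T₀ : UserSet K := ⟨{⟨0, hK⟩}, singleton_nonempty _⟩
  obtain ⟨τ, hlabel, hv, hτ⟩ := σ.exists_pad (v' := fun T => σ.v T + if T = T₀ then
    R - σ.load else 0) fun T => le_add_of_nonneg_right (by split_ifs <;> linarith)
  refine ⟨a, ha, τ, ?_, ?_, fun d k => ?_⟩
  · intro l S
    rw [hlabel]
    exact hσ l S
  · rw [UncodedScheme.load, hv, Finset.sum_add_distrib, Finset.sum_ite_eq' univ T₀,
      if_pos (mem_univ _)]
    change σ.load + _ = R
    ring
  · simp [UncodedScheme.errorProb, hτ, hdec, hε.le]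

end CodedCaching

/- Users are numbered `0, …, K - 1`, so the weight `K - j + 1` of user `j` in the numbering
`1, …, K` is `K - j` here. -/
theorem mainTheorem3 (K N : ℕ) (hKN : K ≤ N) (m : Fin K → ℝ) (hm_nonneg : ∀ j, 0 ≤ m j)
    (hm_mono : Monotone m) (hm_sum : ∑ j, m j ≤ 1) :
    CodedCaching.minLoadUncoded N m = K - ∑ j : Fin K, ((K : ℝ) - (j : ℕ)) * m j ∧
    IsGLB {R | CodedCaching.AchievableUncoded N m R}
      (K - ∑ j : Fin K, ((K : ℝ) - (j : ℕ)) * m j) ∧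
    ∀ F : ℕ, 1 ≤ F → ∃ a ∈ CodedCaching.allocations m, ∃ σ : CodedCaching.UncodedScheme K N F,
      σ.HasAllocation a ∧
      (∀ j, a {j} * F = ⌊m j * F⌋₊) ∧
      (∀ S : Finset (Fin K), 2 ≤ S.card → a S = 0) ∧
      σ.IsXorDelivery ∧
      (∀ j : Fin K, σ.v ⟨{j}, Finset.singleton_nonempty j⟩ * F =
        F - ∑ i with i < j, (⌊m i * F⌋₊ : ℝ) - ((K : ℝ) - (j : ℕ)) * ⌊m j * F⌋₊) ∧
      (∀ i j : Fin K, i ≠ j → σ.v ⟨{i, j}, Finset.insert_nonempty i {j}⟩ * F =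
        min (⌊m i * F⌋₊ : ℝ) ⌊m j * F⌋₊) ∧
      (∀ T : CodedCaching.UserSet K, 3 ≤ T.1.card → σ.v T = 0) ∧
      (∀ d k W, σ.decoded d k W = W (d k)) ∧
      σ.load = K - ∑ j : Fin K, ((K : ℝ) - (j : ℕ)) * (⌊m j * F⌋₊ / F) ∧
      σ.load ≤ K - ∑ j : Fin K, ((K : ℝ) - (j : ℕ)) * m j + K * (K + 1) / (2 * F) := by
  have hscheme : ∀ F : ℕ, 1 ≤ F → ∃ a ∈ CodedCaching.allocations m,
      ∃ σ : CodedCaching.UncodedScheme K N F,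
      σ.HasAllocation a ∧
      (∀ j, a {j} * F = ⌊m j * F⌋₊) ∧
      (∀ S : Finset (Fin K), 2 ≤ S.card → a S = 0) ∧
      σ.IsXorDelivery ∧
      (∀ j : Fin K, σ.v ⟨{j}, Finset.singleton_nonempty j⟩ * F =
        F - ∑ i with i < j, (⌊m i * F⌋₊ : ℝ) - ((K : ℝ) - (j : ℕ)) * ⌊m j * F⌋₊) ∧
      (∀ i j : Fin K, i ≠ j → σ.v ⟨{i, j}, Finset.insert_nonempty i {j}⟩ * F =
        min (⌊m i * F⌋₊ : ℝ) ⌊m j * F⌋₊) ∧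
      (∀ T : CodedCaching.UserSet K, 3 ≤ T.1.card → σ.v T = 0) ∧
      (∀ d k W, σ.decoded d k W = W (d k)) ∧
      σ.load = K - ∑ j : Fin K, ((K : ℝ) - (j : ℕ)) * (⌊m j * F⌋₊ / F) ∧
      σ.load ≤ K - ∑ j : Fin K, ((K : ℝ) - (j : ℕ)) * m j + K * (K + 1) / (2 * F) := by
    intro F hF
    have hF0 : (0 : ℝ) < F := by exact_mod_cast hF
    let n : Fin K → ℕ := fun j => ⌊m j * F⌋₊
    have hn_le : ∀ j, (n j : ℝ) ≤ m j * F := fun j =>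
      Nat.floor_le (mul_nonneg (hm_nonneg j) hF0.le)
    have hn_mono : Monotone n := fun i j hij =>
      Nat.floor_le_floor (mul_le_mul_of_nonneg_right (hm_mono hij) hF0.le)
    have hn_sum : ∑ j, n j ≤ F := by
      have : ∑ j, (n j : ℝ) ≤ F :=
        calc ∑ j, (n j : ℝ) ≤ ∑ j, m j * F := Finset.sum_le_sum fun j _ => hn_le j
          _ = (∑ j, m j) * F := (Finset.sum_mul _ _ _).symm
          _ ≤ F := mul_le_of_le_one_left hF0.le hm_sum
      exact_mod_cast this
    obtain ⟨label, hcard, hone, σ, hσ, hv, hxor, hdec⟩ :=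
      CodedCaching.UncodedScheme.exists_pairwise_xor (N := N) hF hn_sum
    have hload : σ.load = K - ∑ j : Fin K, ((K : ℝ) - (j : ℕ)) * (⌊m j * F⌋₊ / F) := by
      have h : σ.load * F = K * F - ∑ j : Fin K, ((K : ℝ) - (j : ℕ)) * n j := by
        rw [CodedCaching.UncodedScheme.load, Finset.sum_mul, Finset.sum_congr rfl fun T _ => hv T,
          ← CodedCaching.UncodedScheme.sum_pairLength hn_mono hn_sum, Nat.cast_sum]
      rw [eq_div_of_mul_eq hF0.ne' h, sub_div, mul_div_cancel_right₀ _ hF0.ne', Finset.sum_div]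
      simp only [mul_div_assoc, n]
    refine ⟨_, CodedCaching.mem_allocations_of_label hF label fun k => ?_, σ, ?_, ?_, ?_, hxor,
      ?_, ?_, ?_, hdec, hload, hload.trans_le (CodedCaching.load_le_of_floor hF m)⟩
    · rw [hcard]
      exact hn_le k
    · intro l S
      rw [hσ, div_mul_cancel₀ _ hF0.ne']
    · intro j
      rw [div_mul_cancel₀ _ hF0.ne', Nat.cast_inj, ← show n j = ⌊m j * F⌋₊ from rfl, ← hcard j]
      congr 1
      ext i
      simp only [mem_filter, mem_univ, true_and]
      refine ⟨fun h => by simp [h], fun h => ?_⟩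
      exact Finset.eq_singleton_iff_unique_mem.mpr
        ⟨h, fun k hk => Finset.card_le_one.mp (hone i) k hk j h⟩
    · intro S hS
      rw [Finset.filter_false_of_mem fun i _ h => by have := hone i; rw [h] at this; omega]
      simp
    · intro j
      rw [hv, CodedCaching.UncodedScheme.pairLength_singleton, Nat.cast_sub
        ((Finset.sum_le_sum fun i _ => min_le_left _ _).trans hn_sum),
        CodedCaching.UncodedScheme.sum_min_eq hn_mono, sub_add_eq_sub_sub]
    · intro i j hij
      rw [hv, CodedCaching.UncodedScheme.pairLength_pair n hij, Nat.cast_min]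
    · intro T hT
      have := hv T
      rw [CodedCaching.UncodedScheme.pairLength_of_three_le_card n hT, Nat.cast_zero] at this
      exact (mul_eq_zero.mp this).resolve_right hF0.ne'
  have hach : ∀ R > K - ∑ j : Fin K, ((K : ℝ) - (j : ℕ)) * m j,
      0 < K → CodedCaching.AchievableUncoded N m R := by
    intro R hR hK
    refine CodedCaching.achievableUncoded_of_schemes hK ?_
    have hlim : Tendsto (fun F : ℕ => K - ∑ j : Fin K, ((K : ℝ) - (j : ℕ)) * m j +
        (K : ℝ) * (K + 1) / (2 * F)) atTop
        (nhds (K - ∑ j : Fin K, ((K : ℝ) - (j : ℕ)) * m j + 0)) :=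
      tendsto_const_nhds.add (tendsto_const_nhds.div_atTop
        (tendsto_natCast_atTop_atTop.const_mul_atTop (by norm_num)))
    rw [add_zero] at hlim
    filter_upwards [hlim.eventually_le_const hR, eventually_ge_atTop 1] with F hFR hF
    obtain ⟨a, ha, σ, hσ, -, -, -, -, -, -, hdec, -, hload⟩ := hscheme F hF
    exact ⟨a, ha, σ, hσ, hload.trans hFR, hdec⟩
  have hglb : IsGLB {R | CodedCaching.AchievableUncoded N m R}
      (K - ∑ j : Fin K, ((K : ℝ) - (j : ℕ)) * m j) ∧
      {R | CodedCaching.AchievableUncoded N m R}.Nonempty := by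
    -- Without users there is no signal to pad, but load `0` is attained and equals the bound.
    rcases Nat.eq_zero_or_pos K with rfl | hK
    · have h0 : CodedCaching.AchievableUncoded N m 0 := by
        intro ε hε
        filter_upwards [eventually_ge_atTop 1] with F hF
        obtain ⟨a, ha, σ, hσ, -, -, -, -, -, -, -, hload, -⟩ := hscheme F hF
        exact ⟨a, ha, σ, hσ, by simpa using hload, fun _ k => k.elim0⟩
      refine ⟨⟨fun R hR => hR.le hKN, fun b hb => ?_⟩, 0, h0⟩
      simpa using hb h0
    · exact ⟨⟨fun R hR => hR.le hKN, fun b hb => le_of_forall_gt_imp_ge_of_dense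
        fun R hR => hb (hach R hR hK)⟩, _, hach _ (lt_add_one _) hK⟩
  exact ⟨hglb.1.csInf_eq hglb.2, hglb.1, hscheme⟩
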